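/- Let $\Lambda=\mathbb{Z}[h_1,h_2,\dots]$ be the ring of symmetric functions, with complete symmetric functions $h_n$ ($h_0=1$), power sums $p_n$, and Schur functions $s_\mu$. A pre-$\lambda$-ring is a commutative ring $R$ with a map $\sigma_t:R\to R[[t]]$, $\sigma_t(a)=\sum_{n\ge 0} t^n\sigma_n(a)$, such that $\sigma_t(a+b)=\sigma_t(a)\,\sigma_t(b)$, $\sigma_0(a)=1$ and $\sigma_1(a)=a$; put $\lambda_n(a)=(-1)^n\sigma_n(-a)$, and for $f\in\Lambda$ let $f\mapsto f\circ a$ be the ring homomorphism $\Lambda\to R$ with $h_n\circ a=\sigma_n(a)$. A $\lambda$-ring is a pre-$\lambda$-ring such that $f\circ(g\circ a)=(f\circ g)\circ a$ for all $f,g\in\Lambda$ and $a\in R$, where $f\circ g$ is the plethysm in $\Lambda$. Let $\psi_d(x)=p_d\circ x$ be the Adams operations, and define the operations $\Phi_\mu$, indexed by partitions $\mu$, by the generating function $$\sum_\mu s_\mu\otimes\Phi_\mu(x)=\prod_{k=1}^\infty(1+p_k)^{\frac1k\sum_{d\mid k}\mu(k/d)\,\psi_d(x)},$$ where $\mu(k/d)$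 is the Möbius function. That is, for the universal element $x=h_1\in\Lambda$ (so that $\psi_d(x)=p_d$), let $\varphi_\mu\in\Lambda\otimes\mathbb{Q}$ be the coefficient of $s_\mu$ in this product, which lies in the completion of $\Lambda\otimes(\Lambda\otimes\mathbb{Q})$ with respect to the grading of the first factor; if $\varphi_\mu\in\Lambda$, then $\Phi_\mu(y)=\varphi_\mu\circ y$ for every element $y$ of a $\lambda$-ring. For the partitions $(n)$ and $1^n=(1,\dots,1)$ of $n\ge 0$, the elements $\varphi_{(n)}$ and $\varphi_{1^n}$ lie in $\Lambda$, and for every $\lambda$-ring $R$ and every $y\in R$, with $\Phi_n=\Phi_{(n)}$, $$\sum_{n=0}^\infty t^n\,\Phi_n(y)=\frac{\sigma_t(y)}{\sigma_{t^2}(y)}\quad\text{in } R[[t]],\qquad\text{and}\qquad \Phi_{1^n}(y)=\lambda_n(y)\quad\text{for all } n\ge 0.$$ -/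

import Mathlib

open MvPolynomial
open scoped PowerSeries

noncomputable section

namespace SymFn

/-! ### Symmetric functions -/

/-- The ring `Λ` of symmetric functions, presented as the polynomial ring `ℤ[h₁, h₂, …]` in the
complete symmetric functions; the variable with index `i` is `h_{i+1}`. -/
abbrev Lam : Type := MvPolynomial ℕ ℤ

/-- `Λ_ℚ = Λ ⊗ ℚ`. -/
abbrev LamQ : Type := MvPolynomial ℕ ℚ

/-- The inclusion `Λ → Λ_ℚ`. -/
def toLamQ : Lam →+* LamQ := MvPolynomial.map (Int.castRingHom ℚ)

/-- The complete symmetric function `h_n`, with `h_0 = 1`. -/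
def h : ℕ → Lam
  | 0 => 1
  | n + 1 => X n

/-- `h_n` for an integer index, with `h_n = 0` for `n < 0`. -/
def hInt : ℤ → Lam
  | Int.ofNat n => h n
  | Int.negSucc _ => 0

/-- `H_t = ∑ tⁿ h_n`. -/
def H : Lam⟦X⟧ := PowerSeries.mk h

/-- The power sum `p_n` for `n ≥ 1`: the coefficient of `tⁿ` in `t (d/dt) log H_t = t H_t' / H_t`. -/
def p (n : ℕ) : Lam :=
  PowerSeries.coeff n
    (PowerSeries.X * PowerSeries.derivative Lam H * PowerSeries.invOfUnit H 1)

/-- The Schur function `s_μ = det (h_{μ_i - i + j})`, where `μ_1 ≥ μ_2 ≥ …` are the parts. -/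
def schur {n : ℕ} (μ : n.Partition) : Lam :=
  (Matrix.of fun i j : Fin (μ.parts.sort (· ≥ ·)).length =>
    hInt (((μ.parts.sort (· ≥ ·)).get i : ℤ) - (i : ℤ) + (j : ℤ))).det

/-- The symmetric polynomial in `k` variables to which a symmetric function specializes. -/
def toVars (k : ℕ) : Lam →+* MvPolynomial (Fin k) ℤ :=
  (aeval fun i : ℕ => hsymm (Fin k) ℤ (i + 1)).toRingHom

/-! ### Pre-λ-rings and λ-rings -/

/-- A pre-λ-ring: `σ_t : R → R⟦t⟧` turns sums into products, and `σ_t(a) = 1 + t a + O(t²)`. -/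
class PreLambdaRing (R : Type*) [CommRing R] where
  sigmaT : R → R⟦X⟧
  sigmaT_add : ∀ a b : R, sigmaT (a + b) = sigmaT a * sigmaT b
  coeff_zero_sigmaT : ∀ a : R, PowerSeries.coeff 0 (sigmaT a) = 1
  coeff_one_sigmaT : ∀ a : R, PowerSeries.coeff 1 (sigmaT a) = a

section Operations

variable {R : Type*} [CommRing R] [PreLambdaRing R]

/-- `σ_t(a) = ∑ tⁿ σ_n(a)`. -/
def sigmaT (a : R) : R⟦X⟧ := PreLambdaRing.sigmaT a

/-- The operation `σ_n`. -/
def sigma (n : ℕ) (a : R) : R := PowerSeries.coeff n (sigmaT a)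

/-- The operation `λ_n(a) = (-1)ⁿ σ_n(-a)`. -/
def lambda (n : ℕ) (a : R) : R := (-1) ^ n * sigma n (-a)

/-- The operation `f ∘ a` for `f ∈ Λ`, linear in `f`, with
`(h_{n₁} ⋯ h_{n_k}) ∘ a = σ_{n₁}(a) ⋯ σ_{n_k}(a)`. -/
def circ (f : Lam) (a : R) : R := aeval (fun i : ℕ => sigma (i + 1) a) f

end Operations

/-- The unit `1 / (1 - t a) = ∑ tⁿ aⁿ` of `A⟦t⟧`. -/
def geomUnit {A : Type*} [CommRing A] (a : A) : A⟦X⟧ˣ where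
  val := PowerSeries.mk fun n => a ^ n
  inv := 1 - PowerSeries.C a * PowerSeries.X
  val_inv := by
    ext n
    cases n with
    | zero => simp
    | succ n => simp [mul_sub, ← mul_assoc, PowerSeries.coeff_succ_mul_X, pow_succ]
  inv_val := by
    rw [mul_comm]
    ext n
    cases n with
    | zero => simp
    | succ n => simp [mul_sub, ← mul_assoc, PowerSeries.coeff_succ_mul_X, pow_succ]

/-- `σ_t(∑ c_m x^m) = ∏ (1 - t x^m)^{-c_m}` on a polynomial ring over `ℤ`. -/
def polySigmaT {τ : Type*} (f : MvPolynomial τ ℤ) : (MvPolynomial τ ℤ)⟦X⟧ˣ :=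
  (AddMonoidAlgebra.coeff f).prod fun m c => geomUnit (monomial m (1 : ℤ)) ^ c

theorem coeff_zero_units_zpow {A : Type*} [CommRing A] (u : A⟦X⟧ˣ)
    (hu : PowerSeries.coeff 0 (u : A⟦X⟧) = 1) (c : ℤ) :
    PowerSeries.coeff 0 ((u ^ c : A⟦X⟧ˣ) : A⟦X⟧) = 1 := by
  have h1 : Units.map (PowerSeries.constantCoeff (R := A)).toMonoidHom u = 1 := by
    ext; simpa using hu
  have h2 : Units.map (PowerSeries.constantCoeff (R := A)).toMonoidHom (u ^ c) = 1 := by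
    rw [map_zpow, h1, one_zpow]
  rw [PowerSeries.coeff_zero_eq_constantCoeff_apply]
  exact congrArg Units.val h2

theorem coeff_one_mul' {A : Type*} [CommRing A] (f g : A⟦X⟧)
    (hf : PowerSeries.coeff 0 f = 1) (hg : PowerSeries.coeff 0 g = 1) :
    PowerSeries.coeff 1 (f * g) = PowerSeries.coeff 1 f + PowerSeries.coeff 1 g := by
  rw [PowerSeries.coeff_mul, Finset.Nat.antidiagonal_succ]
  simp at hf hg
  simp [hf, hg, add_comm]

theorem coeff_one_units_zpow {A : Type*} [CommRing A] (u : A⟦X⟧ˣ)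
    (hu : PowerSeries.coeff 0 (u : A⟦X⟧) = 1) (c : ℤ) :
    PowerSeries.coeff 1 ((u ^ c : A⟦X⟧ˣ) : A⟦X⟧) = c * PowerSeries.coeff 1 (u : A⟦X⟧) := by
  induction c using Int.induction_on with
  | zero => simp [PowerSeries.coeff_one]
  | succ n ih =>
    rw [zpow_add_one, Units.val_mul, coeff_one_mul' _ _ (coeff_zero_units_zpow u hu _) hu, ih]
    push_cast; ring
  | pred n ih =>
    have : (u ^ (-(n : ℤ)) : A⟦X⟧ˣ) = u ^ (-(n : ℤ) - 1) * u := by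
      rw [← zpow_add_one]; congr 1; ring
    rw [this, Units.val_mul, coeff_one_mul' _ _ (coeff_zero_units_zpow u hu _) hu] at ih
    push_cast at ih ⊢
    linear_combination ih

theorem coeff_zero_one_prod {A ι : Type*} [CommRing A] (s : Finset ι) (u : ι → A⟦X⟧)
    (hu : ∀ i, PowerSeries.coeff 0 (u i) = 1) :
    PowerSeries.coeff 0 (∏ i ∈ s, u i) = 1 ∧
      PowerSeries.coeff 1 (∏ i ∈ s, u i) = ∑ i ∈ s, PowerSeries.coeff 1 (u i) := by
  classical
  induction s using Finset.induction_on with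
  | empty => simp [PowerSeries.coeff_one]
  | insert a s ha ih =>
    rw [Finset.prod_insert ha, Finset.sum_insert ha, coeff_one_mul' _ _ (hu a) ih.1, ih.2]
    refine ⟨?_, rfl⟩
    have h1 := hu a
    have h2 := ih.1
    simp only [PowerSeries.coeff_zero_eq_constantCoeff, map_mul] at h1 h2 ⊢
    rw [h1, h2, one_mul]

/-- The pre-λ-ring structure on a polynomial ring over `ℤ` for which `σ_n(x^m) = x^{nm}`. -/
instance instPreLambdaRingMvPolynomial (τ : Type*) : PreLambdaRing (MvPolynomial τ ℤ) where
  sigmaT f := (polySigmaT f : (MvPolynomial τ ℤ)⟦X⟧)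
  sigmaT_add f g := by
    classical
    rw [← Units.val_mul]
    congr 1
    unfold polySigmaT
    rw [AddMonoidAlgebra.coeff_add]
    exact Finsupp.prod_add_index' (fun _ => zpow_zero _) (fun _ _ _ => zpow_add _ _ _)
  coeff_zero_sigmaT f := by
    unfold polySigmaT Finsupp.prod
    rw [Units.coe_prod]
    exact (coeff_zero_one_prod _ _ fun m =>
      coeff_zero_units_zpow _ (by simp [geomUnit]) _).1
  coeff_one_sigmaT f := by
    unfold polySigmaT Finsupp.prod
    rw [Units.coe_prod, (coeff_zero_one_prod _ _ fun m =>
      coeff_zero_units_zpow _ (by simp [geomUnit]) _).2]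
    conv_rhs => rw [f.as_sum]
    refine Finset.sum_congr rfl fun m _ => ?_
    rw [coeff_one_units_zpow _ (by simp [geomUnit])]
    simp only [geomUnit, PowerSeries.coeff_mk, pow_one]
    rw [← zsmul_eq_mul, ← map_zsmul]
    simp
    rfl

/-- `q` is the plethysm `f ∘ g` in `Λ`: in every finite number of variables, `q` is the result of
applying `f` to the polynomial `g` in the pre-λ-ring `ℤ[x₁, …, x_k]`. (The pre-λ-ring structure of
`Λ` is the limit of those of the symmetric polynomials; `q` is unique, since a symmetric function
is determined by its specializations to finitely many variables.) -/
def IsPlethysm (f g q : Lam) : Prop :=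
  ∀ k : ℕ, toVars k q = circ f (toVars k g)

/-- A λ-ring: a pre-λ-ring in which `f ∘ (g ∘ x) = (f ∘ g) ∘ x` for all `f, g ∈ Λ`. -/
class LambdaRing (R : Type*) [CommRing R] extends PreLambdaRing R where
  circ_circ : ∀ f g q : Lam, IsPlethysm f g q → ∀ x : R, circ f (circ g x) = circ q x

/-! ### The Schur functions form a basis -/

/-- The degree of a monomial in the `h_n`, where `h_n` has degree `n`. -/
def wt (m : ℕ →₀ ℕ) : ℕ := Finsupp.weight (fun i : ℕ => i + 1) m

/-- The exponent of the monomial `h_μ = ∏ h_{μ_i}`. -/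
def expo {n : ℕ} (μ : n.Partition) : ℕ →₀ ℕ := Multiset.toFinsupp (μ.parts.map Nat.pred)

theorem wt_toFinsupp (s : Multiset ℕ) :
    wt (Multiset.toFinsupp s) = (s.map (· + 1)).sum := by
  induction s using Multiset.induction_on with
  | empty => simp [wt]
  | cons a s ih =>
    rw [← Multiset.singleton_add, map_add, wt, map_add, ← wt, ← wt, ih]
    simp [wt, Multiset.toFinsupp_singleton, Finsupp.weight_single]

theorem parts_map_pred_succ {n : ℕ} (μ : n.Partition) :
    (μ.parts.map Nat.pred).map (· + 1) = μ.parts := by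
  rw [Multiset.map_map]
  conv_rhs => rw [← Multiset.map_id μ.parts]
  refine Multiset.map_congr rfl fun x hx => ?_
  have := μ.parts_pos hx
  simp; omega

theorem wt_expo {n : ℕ} (μ : n.Partition) : wt (expo μ) = n := by
  rw [expo, wt_toFinsupp, parts_map_pred_succ, μ.parts_sum]

theorem expo_injective {n : ℕ} : Function.Injective (expo (n := n)) := by
  intro μ ν hh
  have := Multiset.toFinsupp.injective hh
  apply Nat.Partition.ext
  rw [← parts_map_pred_succ μ, ← parts_map_pred_succ ν, this]

theorem exists_expo {n : ℕ} (m : ℕ →₀ ℕ) (hm : wt m = n) : ∃ μ : n.Partition, expo μ = m := by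
  obtain ⟨s, rfl⟩ := Multiset.toFinsupp.surjective m
  refine ⟨⟨s.map (· + 1), ?_, ?_⟩, ?_⟩
  · intro i hi
    obtain ⟨j, -, rfl⟩ := Multiset.mem_map.1 hi
    omega
  · rw [← wt_toFinsupp, hm]
  · simp [expo, Multiset.map_map]

/-- The sum of the squares of the parts of a monomial in the `h_n`. -/
def sqWt : (ℕ →₀ ℕ) →+ ℤ := Finsupp.weight (fun i : ℕ => ((i : ℤ) + 1) ^ 2)

/-- The exponent of the monomial `h_z`. -/
def hExpo (z : ℤ) : ℕ →₀ ℕ := if z = 0 then 0 else Finsupp.single (z.toNat - 1) 1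

theorem hInt_of_neg {z : ℤ} (hz : z < 0) : hInt z = 0 := by
  cases z with
  | ofNat n => simp at hz; omega
  | negSucc n => rfl

theorem hInt_of_nonneg {z : ℤ} (hz : 0 ≤ z) : hInt z = monomial (hExpo z) 1 := by
  lift z to ℕ using hz
  cases z with
  | zero => simp [hInt, h, hExpo]
  | succ n =>
    have h1 : ((n + 1 : ℕ) : ℤ) ≠ 0 := by omega
    have h2 : ((n + 1 : ℕ) : ℤ).toNat - 1 = n := by omega
    rw [hExpo, if_neg h1, h2]
    rfl

theorem sqWt_hExpo {z : ℤ} (hz : 0 ≤ z) : sqWt (hExpo z) = z ^ 2 := by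
  unfold hExpo
  split_ifs with h0
  · simp [h0]
  · have : (((z.toNat - 1 : ℕ) : ℤ) + 1) = z := by omega
    simp [sqWt, Finsupp.weight_single, this]

theorem coeff_prod_hInt {ι : Type*} [Fintype ι] (z : ι → ℤ) (m : ℕ →₀ ℕ) :
    coeff m (∏ i, hInt (z i)) =
      if (∀ i, 0 ≤ z i) ∧ ∑ i, hExpo (z i) = m then 1 else 0 := by
  classical
  by_cases hz : ∀ i, 0 ≤ z i
  · rw [Finset.prod_congr rfl fun i _ => hInt_of_nonneg (hz i), ← monomial_sum_one, coeff_monomial]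
    simp [hz]
  · rw [if_neg fun hh => hz hh.1]
    push Not at hz
    obtain ⟨i, hi⟩ := hz
    rw [Finset.prod_eq_zero (Finset.mem_univ i) (hInt_of_neg hi), coeff_zero]

/-- The matrix of the Schur functions in terms of the monomials `h_μ`. -/
def schurMatrix (n : ℕ) : Matrix n.Partition n.Partition ℤ :=
  Matrix.of fun μ ν => coeff (expo ν) (schur μ)

theorem sum_sq_lt {l : ℕ} (a : Fin l → ℤ) (ha : StrictAnti a) (w : Equiv.Perm (Fin l))
    (hw : w ≠ 1) : ∑ i, (a i + (i : ℤ)) ^ 2 < ∑ i, (a i + ((w i : Fin l) : ℤ)) ^ 2 := by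
  have hanti : Antivary a (fun i : Fin l => (i : ℤ)) := by
    intro i j hij
    exact (ha (by simpa using hij)).le
  have hlt : ∑ i, a i * (i : ℤ) < ∑ i, a i * ((w i : Fin l) : ℤ) := by
    have key := hanti.sum_smul_lt_sum_smul_comp_perm_iff (σ := w)
    simp only [smul_eq_mul] at key
    rw [key]
    intro hh
    apply hw
    have hmono : Monotone (w.symm) := by
      intro x y hxy
      rcases hxy.eq_or_lt with rfl | hxy
      · exact le_rfl
      · have := hh (i := w.symm x) (j := w.symm y) (by simpa using hxy)
        exact ha.le_iff_ge.1 this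
    have hs : w.symm = 1 := by
      have hsm : StrictMono w.symm := hmono.strictMono_of_injective w.symm.injective
      have := Subsingleton.elim (hsm.orderIsoOfSurjective _ w.symm.surjective)
        (OrderIso.refl (Fin l))
      ext1 x
      exact congrArg (fun e : Fin l ≃o Fin l => e x) this
    rw [← Equiv.symm_symm w, hs]; rfl
  have hsq : ∑ i, (((w i : Fin l) : ℤ)) ^ 2 = ∑ i : Fin l, (i : ℤ) ^ 2 :=
    Equiv.sum_comp w fun i : Fin l => (i : ℤ) ^ 2
  simp only [add_sq, Finset.sum_add_distrib, mul_assoc, ← Finset.mul_sum]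
  linarith

theorem schur_term_id {n : ℕ} (μ : n.Partition) :
    ∑ i : Fin (μ.parts.sort (· ≥ ·)).length,
      hExpo ((((μ.parts.sort (· ≥ ·)).get i : ℕ) : ℤ)) = expo μ := by
  have h1 : ((μ.parts.sort (· ≥ ·)).map fun k : ℕ => hExpo (k : ℤ)).sum = expo μ := by
    rw [← Multiset.sum_coe, ← Multiset.map_coe, Multiset.sort_eq, expo]
    have hp : ∀ k ∈ μ.parts, hExpo (k : ℤ) = Finsupp.single (Nat.pred k) 1 := by
      intro k hk
      have := μ.parts_pos hk
      rw [hExpo, if_neg (by omega)]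
      congr 1
    rw [Multiset.map_congr rfl hp]
    clear hp
    induction μ.parts using Multiset.induction_on with
    | empty => simp
    | cons a s ih =>
      rw [Multiset.map_cons, Multiset.sum_cons, ih, Multiset.map_cons, ← Multiset.singleton_add,
        map_add, Multiset.toFinsupp_singleton]
  rw [← h1, ← List.sum_ofFn]
  congr 1
  apply List.ext_get <;> simp

theorem schurMatrix_eq {n : ℕ} (μ ν : n.Partition)
    (hle : sqWt (expo ν) ≤ sqWt (expo μ)) :
    schurMatrix n μ ν = if μ = ν then 1 else 0 := by
  classical
  set L := μ.parts.sort (· ≥ ·) with hL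
  let a : Fin L.length → ℤ := fun i => (L.get i : ℤ) - (i : ℤ)
  have ha : StrictAnti a := by
    intro i j hij
    have h1 : L.get j ≤ L.get i :=
      (Multiset.pairwise_sort μ.parts (· ≥ ·)).rel_get_of_lt hij
    have h2 : (i : ℕ) < j := hij
    simp only [a]
    omega
  have hid : ∀ i : Fin L.length, a i + (i : ℤ) = L.get i := fun i => by simp [a]
  have hterm : ∀ w : Equiv.Perm (Fin L.length),
      coeff (expo ν) (∏ i, hInt (a i + ((w i : Fin _) : ℤ))) =
        if w = 1 then (if μ = ν then 1 else 0) else 0 := by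
    intro w
    rw [coeff_prod_hInt]
    by_cases hw : w = 1
    · subst hw
      simp only [Equiv.Perm.coe_one, id, if_true, hid]
      rw [schur_term_id μ]
      simp [expo_injective.eq_iff]
    · rw [if_neg hw, if_neg]
      rintro ⟨hz, hs⟩
      have h1 : sqWt (expo ν) = ∑ i, (a i + ((w i : Fin _) : ℤ)) ^ 2 := by
        rw [← hs, map_sum]
        exact Finset.sum_congr rfl fun i _ => sqWt_hExpo (hz i)
      have h2 : sqWt (expo μ) = ∑ i : Fin L.length, (a i + (i : ℤ)) ^ 2 := by
        rw [← schur_term_id μ, map_sum]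
        exact Finset.sum_congr rfl fun i _ => by
          rw [hid, sqWt_hExpo (by positivity)]
      have := sum_sq_lt a ha w hw
      omega
  have hdet : schur μ = ∑ w : Equiv.Perm (Fin L.length),
      Equiv.Perm.sign w • ∏ i, hInt (a i + ((w i : Fin _) : ℤ)) := by
    rw [schur, ← Matrix.det_transpose, Matrix.det_apply]
    rfl
  rw [schurMatrix, Matrix.of_apply, hdet, coeff_sum,
    Finset.sum_eq_single (1 : Equiv.Perm (Fin L.length))]
  · rw [Equiv.Perm.sign_one, one_smul, hterm, if_pos rfl]
  · intro w _ hw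
    rw [Units.smul_def, coeff_smul, hterm, if_neg hw, smul_zero]
  · simp

theorem schurMatrix_det (n : ℕ) : (schurMatrix n).det = 1 := by
  classical
  have hb : (schurMatrix n).BlockTriangular fun μ => sqWt (expo μ) := by
    intro μ ν hlt
    rw [schurMatrix_eq μ ν hlt.le, if_neg]
    rintro rfl
    exact lt_irrefl _ hlt
  rw [hb.det]
  refine Finset.prod_eq_one fun k _ => ?_
  have : (schurMatrix n).toSquareBlock (fun μ => sqWt (expo μ)) k = 1 := by
    ext ⟨μ, hμ⟩ ⟨ν, hν⟩
    rw [Matrix.toSquareBlock_def, Matrix.of_apply, schurMatrix_eq μ ν (by rw [hμ, hν]),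
      Matrix.one_apply]
    simp
  rw [this, Matrix.det_one]

/-- In each degree `n`, an element of `Λ ⊗̂ A` has a unique expansion `∑_{μ ⊢ n} s_μ ⊗ φ_μ`. -/
theorem existsUnique_schur_expansion {A : Type*} [CommRing A] (F : MvPowerSeries ℕ A) (n : ℕ) :
    ∃! φ : n.Partition → A, ∀ m : ℕ →₀ ℕ, wt m = n →
      MvPowerSeries.coeff m F = ∑ μ : n.Partition, ((coeff m (schur μ) : ℤ) : A) * φ μ := by
  classical
  let M : Matrix n.Partition n.Partition A := ((schurMatrix n).map (Int.castRingHom A)).transpose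
  have hM : IsUnit M.det := by
    rw [Matrix.det_transpose, ← RingHom.mapMatrix_apply, ← RingHom.map_det, schurMatrix_det]
    simp
  let v : n.Partition → A := fun ν => MvPowerSeries.coeff (expo ν) F
  have hiff : ∀ φ : n.Partition → A, (∀ m : ℕ →₀ ℕ, wt m = n →
      MvPowerSeries.coeff m F = ∑ μ : n.Partition, ((coeff m (schur μ) : ℤ) : A) * φ μ) ↔
      M.mulVec φ = v := by
    intro φ
    constructor
    · intro hφ
      ext ν
      rw [show v ν = _ from hφ _ (wt_expo ν)]
      rfl
    · intro hφ m hm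
      obtain ⟨ν, rfl⟩ := exists_expo m hm
      exact (congrFun hφ ν).symm
  refine ⟨M⁻¹.mulVec v, (hiff _).2 ?_, fun φ hφ => ?_⟩
  · rw [Matrix.mulVec_mulVec, Matrix.mul_nonsing_inv _ hM, Matrix.one_mulVec]
  · rw [← (hiff φ).1 hφ, Matrix.mulVec_mulVec, Matrix.nonsing_inv_mul _ hM, Matrix.one_mulVec]

/-! ### The operations `Φ_μ` -/

/-- The image of `p_k` in `Λ ⊗̂ Λ_ℚ` under `f ↦ f ⊗ 1`, where `Λ ⊗̂ A` (the completion of `Λ ⊗ A` for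
the grading of `Λ`) is the ring of power series over `A` in the variables `h₁, h₂, …`. -/
def pSeries (k : ℕ) : MvPowerSeries ℕ LamQ :=
  (MvPolynomial.map (Int.castRingHom LamQ) (p k) : MvPolynomial ℕ LamQ)

theorem constantCoeff_p (k : ℕ) : constantCoeff (p k) = 0 := by
  have h1 : PowerSeries.map (constantCoeff (R := ℤ) (σ := ℕ)) H = 1 := by
    ext n
    cases n with
    | zero => simp [H, h]
    | succ n => simp [H, h, PowerSeries.coeff_one]
  have h2 : PowerSeries.map (constantCoeff (R := ℤ) (σ := ℕ)) (PowerSeries.derivative Lam H) = 0 := by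
    ext n
    have := congrArg (PowerSeries.coeff (n + 1)) h1
    rw [PowerSeries.coeff_map] at this
    rw [PowerSeries.coeff_map]
    simp only [PowerSeries.coeff_derivative, map_mul, this]
    simp [PowerSeries.coeff_one]
  rw [p, ← PowerSeries.coeff_map, RingHom.map_mul, RingHom.map_mul, h2]
  simp

theorem hasSubst_pSeries (k : ℕ) : PowerSeries.HasSubst (pSeries k) := by
  apply PowerSeries.HasSubst.of_constantCoeff_zero
  rw [← MvPowerSeries.coeff_zero_eq_constantCoeff_apply, pSeries, MvPolynomial.coeff_coe,
    MvPolynomial.coeff_map]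
  have := constantCoeff_p k
  rw [MvPolynomial.constantCoeff_eq] at this
  simp [this]

/-- The exponent `(1/k) ∑_{d ∣ k} μ(k/d) ψ_d(x)` for the universal element `x = h₁ ∈ Λ`, for which
`ψ_d(x) = p_d`. -/
def expoPhi (k : ℕ) : LamQ :=
  (1 / k : ℚ) • ∑ d ∈ k.divisors, (ArithmeticFunction.moebius (k / d) : LamQ) * toLamQ (p d)

/-- The factor `(1 + p_k) ^ ((1/k) ∑_{d ∣ k} μ(k/d) ψ_d(x))`, by the binomial series. -/
def phiFactor (k : ℕ) : MvPowerSeries ℕ LamQ :=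
  PowerSeries.subst (pSeries k) (PowerSeries.binomialSeries LamQ (expoPhi k))

/-- The generating function `Φ(x) = ∏_{k ≥ 1} (1 + p_k) ^ ((1/k) ∑_{d ∣ k} μ(k/d) ψ_d(x))` in
`Λ ⊗̂ Λ_ℚ` for the universal element `x = h₁`. The `k`-th factor is `1` plus terms of degree at
least `k`, so the coefficient of a monomial of degree `n` only involves the factors with
`k ≤ n`. -/
def phiSeries : MvPowerSeries ℕ LamQ := fun m =>
  MvPowerSeries.coeff m (∏ k ∈ Finset.Icc 1 (wt m), phiFactor k)

/-- The element `φ_μ` of `Λ_ℚ`: the coefficient of `s_μ` in `Φ(x) = ∑_μ s_μ ⊗ Φ_μ(x)`, for the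
universal element `x = h₁`. -/
def phiQ {n : ℕ} (μ : n.Partition) : LamQ :=
  (existsUnique_schur_expansion phiSeries n).choose μ

/-- `Φ(x) = ∑_μ s_μ ⊗ Φ_μ(x)`. -/
theorem phiQ_spec (m : ℕ →₀ ℕ) :
    MvPowerSeries.coeff m phiSeries =
      ∑ μ : (wt m).Partition, ((coeff m (schur μ) : ℤ) : LamQ) * phiQ μ :=
  (existsUnique_schur_expansion phiSeries (wt m)).choose_spec.1 m rfl

/-- The element of `Λ` whose image in `Λ_ℚ` is `φ_μ`. -/
def phi {n : ℕ} (μ : n.Partition) : Lam := Function.invFun toLamQ (phiQ μ)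

/-- The operation `Φ_μ` on a (pre-)λ-ring: `Φ_μ(y) = φ_μ ∘ y`. -/
def Phi {R : Type*} [CommRing R] [PreLambdaRing R] {n : ℕ} (μ : n.Partition) (y : R) : R :=
  circ (phi μ) y

/-- The partition `(n)` of `n`, which is empty for `n = 0`. -/
abbrev row (n : ℕ) : n.Partition := Nat.Partition.indiscrete n

/-- The partition `1ⁿ = (1, …, 1)` of `n`. -/
def column (n : ℕ) : n.Partition where
  parts := Multiset.replicate n 1
  parts_pos hi := by rw [Multiset.eq_of_mem_replicate hi]; exact one_pos
  parts_sum := by simp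

end SymFn

end

noncomputable section

namespace SymFn

/-! ### Logarithmic derivatives of power series -/

/-! The coefficients of `s_(n)` and `s_{1ⁿ}` in `Φ(x)` are isolated by specializing the first tensor
factor. Under `h_n ↦ tⁿ` (a single variable) every Schur function vanishes except those of one row,
and `p_k ↦ t^k`; under `h_1 ↦ t`, `h_n ↦ 0` for `n ≥ 2` only the one-column ones survive, and `p_k ↦
(-1)^(k-1) t^k` (`spec_row_schur`, `spec_column_schur`, `spec_row_p`, `spec_column_p`). So `∑ φ_μ
tⁿ`, over rows or over columns, equals `∏ (1 + ε_k t^k)^(N_k / k)` with `N_k = ∑_{d ∣ k} μ(k/d) p_d`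
and the corresponding signs `ε_k`.

These products are computed through `t d/dt log`. The `k`-th factor contributes `N_k ε_k t^k / (1 +
ε_k t^k)` (`isLogDeriv_subst_binomialSeries`), so the coefficient of `t^m` is `∑_{k ∣ m} N_k ·
(-(-ε_k)^(m/k))`. Möbius inversion gives `∑_{k ∣ m} N_k = p_m`. For `ε_k = 1` the terms with `m/k`
even change sign, and the total is `p_m - 2 p_{m/2}` (the second term only for even `m`), as for
`H_t / H_{t²}`. For `ε_k = (-1)^(k-1)` the sign is `-(-1)^m` throughout, as for `1 / H_{-t}`.

A series with constant term `1` over a torsion-free ring is determined by its logarithmic derivative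
(`IsLogDeriv.coeff_eq`), so the products are these two series. Their coefficients lie in `Λ`, which
gives integrality, and applying `f ↦ f ∘ y`, which sends `H_t` to `σ_t(y)`, gives the stated
formulas. -/

/-- `g` is the logarithmic derivative `t f' / f` of the power series `f`. -/
def IsLogDeriv {A : Type*} [CommRing A] (f g : A⟦X⟧) : Prop :=
  PowerSeries.X * PowerSeries.derivative A f = g * f

theorem coeff_X_mul_derivative {A : Type*} [CommRing A] (f : A⟦X⟧) (n : ℕ) :
    PowerSeries.coeff n (PowerSeries.X * PowerSeries.derivative A f) =
      n * PowerSeries.coeff n f := by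
  cases n with
  | zero => simp
  | succ n =>
    rw [PowerSeries.coeff_succ_X_mul, PowerSeries.coeff_derivative]
    push_cast; ring

namespace IsLogDeriv

variable {A : Type*} [CommRing A] {f g f' g' : A⟦X⟧}

theorem one : IsLogDeriv (1 : A⟦X⟧) 0 := by
  simp [IsLogDeriv]

theorem mul (h : IsLogDeriv f g) (h' : IsLogDeriv f' g') : IsLogDeriv (f * f') (g + g') := by
  unfold IsLogDeriv at *
  rw [Derivation.leibniz, smul_eq_mul, smul_eq_mul]
  linear_combination f' * h + f * h'

theorem prod {ι : Type*} (s : Finset ι) {F G : ι → A⟦X⟧} (h : ∀ i ∈ s, IsLogDeriv (F i) (G i)) :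
    IsLogDeriv (∏ i ∈ s, F i) (∑ i ∈ s, G i) := by
  classical
  induction s using Finset.induction_on with
  | empty => simpa using one
  | insert a s ha ih =>
    rw [Finset.prod_insert ha, Finset.sum_insert ha]
    exact (h a (Finset.mem_insert_self a s)).mul
      (ih fun i hi => h i (Finset.mem_insert_of_mem hi))

theorem of_mul_eq_one (h : IsLogDeriv f g) (hf : f * f' = 1) : IsLogDeriv f' (-g) := by
  unfold IsLogDeriv at *
  have h1 : PowerSeries.derivative A (f * f') = 0 := by
    rw [hf, PowerSeries.derivative_one]
  rw [Derivation.leibniz, smul_eq_mul, smul_eq_mul] at h1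
  linear_combination (-PowerSeries.X * PowerSeries.derivative A f' - g * f') * hf +
    PowerSeries.X * f' * h1 - f' ^ 2 * h

/-- The operator `t d/dt` multiplies degree `m` by `m`, and `t ↦ t^k` moves degree `m` to `k m`;
this is the source of the factor `k`. -/
theorem expand (h : IsLogDeriv f g) {k : ℕ} (hk : k ≠ 0) :
    IsLogDeriv (PowerSeries.expand k hk f) ((k : A⟦X⟧) * PowerSeries.expand k hk g) := by
  unfold IsLogDeriv at *
  rw [mul_assoc, ← map_mul, ← h]
  ext n
  rw [coeff_X_mul_derivative, ← map_natCast (PowerSeries.C (R := A)), PowerSeries.coeff_C_mul,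
    PowerSeries.coeff_expand, PowerSeries.coeff_expand]
  split_ifs with hn
  · obtain ⟨m, rfl⟩ := hn
    rw [Nat.mul_div_cancel_left _ (Nat.pos_of_ne_zero hk), coeff_X_mul_derivative]
    push_cast; ring
  · simp

theorem rescale (h : IsLogDeriv f g) (a : A) :
    IsLogDeriv (PowerSeries.rescale a f) (PowerSeries.rescale a g) := by
  unfold IsLogDeriv at *
  rw [← map_mul, ← h]
  ext n
  rw [coeff_X_mul_derivative, PowerSeries.coeff_rescale, PowerSeries.coeff_rescale,
    coeff_X_mul_derivative]
  ring

theorem map {B : Type*} [CommRing B] (h : IsLogDeriv f g) (φ : A →+* B) :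
    IsLogDeriv (PowerSeries.map φ f) (PowerSeries.map φ g) := by
  unfold IsLogDeriv at *
  rw [← map_mul, ← h]
  ext n
  simp only [coeff_X_mul_derivative, PowerSeries.coeff_map, map_natCast, φ.map_mul]

/-- A power series is determined up to degree `n` by its constant coefficient and by its
logarithmic derivative up to degree `n`. -/
theorem coeff_eq [IsAddTorsionFree A] (h : IsLogDeriv f g) (h' : IsLogDeriv f' g')
    (h0 : PowerSeries.coeff 0 f = PowerSeries.coeff 0 f')
    (hg : PowerSeries.coeff 0 g = 0) (n : ℕ)
    (hgg : ∀ m ≤ n, PowerSeries.coeff m g = PowerSeries.coeff m g') :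
    PowerSeries.coeff n f = PowerSeries.coeff n f' := by
  induction n using Nat.strong_induction_on with
  | _ n ih =>
    rcases Nat.eq_zero_or_pos n with rfl | hn
    · exact h0
    have key := congrArg (PowerSeries.coeff n) h
    have key' := congrArg (PowerSeries.coeff n) h'
    rw [coeff_X_mul_derivative, PowerSeries.coeff_mul] at key key'
    have hs : (n : A) * PowerSeries.coeff n f = n * PowerSeries.coeff n f' := by
      rw [key, key']
      refine Finset.sum_congr rfl fun ij hij => ?_
      have hsum := Finset.HasAntidiagonal.mem_antidiagonal.1 hij
      -- Since `g` has no constant term, the recursion for `n f_n` involves only coefficients of `f`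
      -- below `n`.
      rcases Nat.eq_zero_or_pos ij.1 with hi | hi
      · rw [← hgg _ (by omega), hi, hg, zero_mul, zero_mul]
      · rw [hgg _ (by omega), ih ij.2 (by omega) fun m hm => hgg m (by omega)]
    rw [← nsmul_eq_mul, ← nsmul_eq_mul] at hs
    exact nsmul_right_injective hn.ne' hs

end IsLogDeriv

theorem isLogDeriv_H : IsLogDeriv H (PowerSeries.mk p) := by
  have h1 : H * PowerSeries.invOfUnit H 1 = 1 :=
    PowerSeries.mul_invOfUnit _ _ (by simp [H, h])
  have h2 : PowerSeries.mk p =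
      PowerSeries.X * PowerSeries.derivative Lam H * PowerSeries.invOfUnit H 1 := by
    ext1 n; simp [p]
  unfold IsLogDeriv
  rw [h2]
  linear_combination (-PowerSeries.X * PowerSeries.derivative Lam H) * h1

theorem p_zero : p 0 = 0 := by
  rw [p, mul_assoc, PowerSeries.coeff_zero_X_mul]

/-! ### The binomial factors -/

/-- Cancel `n!` in the recursion of the descending Pochhammer polynomials. This is the coefficient
form of the equation `(1 + X) F' = a F` for `F = (1 + X)^a`. -/
theorem succ_mul_choose {A : Type*} [CommRing A] [BinomialRing A] (a : A) (n : ℕ) :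
    ((n : A) + 1) * Ring.choose a (n + 1) = (a - n) * Ring.choose a n := by
  have h1 := Ring.descPochhammer_eq_factorial_smul_choose a (n + 1)
  have h2 := Ring.descPochhammer_eq_factorial_smul_choose a n
  rw [descPochhammer_succ_right, Polynomial.smeval_mul, h2] at h1
  have h3 : Polynomial.smeval ((Polynomial.X : Polynomial ℤ) - (n : Polynomial ℤ)) a = a - n := by
    rw [Polynomial.smeval_sub, Polynomial.smeval_X, Polynomial.smeval_natCast]
    simp
  rw [h3, Nat.factorial_succ, mul_comm (n + 1), mul_smul, smul_mul_assoc] at h1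
  have := BinomialRing.toIsAddTorsionFree (R := A)
  have := nsmul_right_injective (M := A) (Nat.factorial_ne_zero n) h1
  rw [nsmul_eq_mul] at this
  push_cast at this
  rw [← this]; ring

theorem one_add_X_mul_derivative_binomialSeries {A : Type*} [CommRing A] [BinomialRing A] (a : A) :
    (1 + PowerSeries.X) * PowerSeries.derivative A (PowerSeries.binomialSeries A a) =
      PowerSeries.C a * PowerSeries.binomialSeries A a := by
  ext n
  rw [add_mul, one_mul, map_add, coeff_X_mul_derivative, PowerSeries.coeff_derivative,
    PowerSeries.coeff_C_mul]
  simp only [PowerSeries.binomialSeries_coeff, smul_eq_mul, mul_one]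
  linear_combination succ_mul_choose a n

/-- The power series `1 / (1 + ε tᵏ)`. -/
def invOneAddPow {A : Type*} [CommRing A] (ε : A) (k : ℕ) (hk : k ≠ 0) : A⟦X⟧ :=
  PowerSeries.expand k hk (geomUnit (-ε) : A⟦X⟧)

theorem one_add_mul_invOneAddPow {A : Type*} [CommRing A] (ε : A) (k : ℕ) (hk : k ≠ 0) :
    (1 + PowerSeries.C ε * PowerSeries.X ^ k) * invOneAddPow ε k hk = 1 := by
  have h1 : (1 + PowerSeries.C ε * PowerSeries.X ^ k : A⟦X⟧) =
      PowerSeries.expand k hk (geomUnit (-ε)).inv := by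
    simp [geomUnit, PowerSeries.expand_C]
  rw [h1, invOneAddPow, ← map_mul, (geomUnit (-ε)).inv_val, map_one]

theorem coeff_one_sub_invOneAddPow {A : Type*} [CommRing A] (ε : A) (k : ℕ) (hk : k ≠ 0) {m : ℕ}
    (hm : m ≠ 0) : PowerSeries.coeff m (1 - invOneAddPow ε k hk) =
      if k ∣ m then -(-ε) ^ (m / k) else 0 := by
  rw [map_sub, PowerSeries.coeff_one, if_neg hm, invOneAddPow, PowerSeries.coeff_expand]
  split_ifs <;> simp [geomUnit]

theorem hasSubst_C_mul_X_pow {A : Type*} [CommRing A] (ε : A) {k : ℕ} (hk : k ≠ 0) :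
    PowerSeries.HasSubst (PowerSeries.C ε * PowerSeries.X ^ k : A⟦X⟧) :=
  PowerSeries.HasSubst.of_constantCoeff_zero' (by simp [hk])

/-- Put `b = ε t^k`, so that `t b' = k b`. Substituting `b` in `(1 + X) F' = a F` gives the
logarithmic derivative `k a b / (1 + b)`, and `b / (1 + b) = 1 - 1 / (1 + b)`. -/
theorem isLogDeriv_subst_binomialSeries {A : Type*} [CommRing A] [BinomialRing A] (a ε : A)
    (k : ℕ) (hk : k ≠ 0) :
    IsLogDeriv
      (PowerSeries.subst (PowerSeries.C ε * PowerSeries.X ^ k : A⟦X⟧)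
        (PowerSeries.binomialSeries A a))
      (PowerSeries.C (k * a) * (1 - invOneAddPow ε k hk)) := by
  obtain ⟨b, hb⟩ : ∃ b : A⟦X⟧, b = PowerSeries.C ε * PowerSeries.X ^ k := ⟨_, rfl⟩
  rw [← hb]
  have hs : PowerSeries.HasSubst b := hb ▸ hasSubst_C_mul_X_pow ε hk
  have h1 := congrArg (PowerSeries.subst b) (one_add_X_mul_derivative_binomialSeries a)
  rw [PowerSeries.subst_mul hs, PowerSeries.subst_mul hs, PowerSeries.subst_add hs,
    PowerSeries.subst_X hs, ← PowerSeries.coe_substAlgHom hs, map_one,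
    PowerSeries.coe_substAlgHom hs] at h1
  have h2 : PowerSeries.subst b (PowerSeries.C a) = PowerSeries.C a := PowerSeries.subst_C a
  rw [h2] at h1
  have h3 : PowerSeries.X * PowerSeries.derivative A b = (k : A⟦X⟧) * b := by
    ext n
    rw [coeff_X_mul_derivative, ← map_natCast (PowerSeries.C (R := A)), PowerSeries.coeff_C_mul]
    by_cases hn : n = k
    · rw [hn]
    · simp [hb, PowerSeries.coeff_X_pow, hn]
  have h4 := one_add_mul_invOneAddPow ε k hk
  rw [← hb] at h4
  unfold IsLogDeriv
  rw [PowerSeries.derivative_subst hs, (PowerSeries.C (R := A)).map_mul, map_natCast]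
  set v := invOneAddPow ε k hk
  set D := PowerSeries.subst b (PowerSeries.derivative A (PowerSeries.binomialSeries A a))
  set F := PowerSeries.subst b (PowerSeries.binomialSeries A a)
  linear_combination D * h3 + (k : A⟦X⟧) * b * v * h1 - ((k : A⟦X⟧) * b * D - k * PowerSeries.C a * F) * h4

/-! ### Specializations of the first factor -/

/-- The power series `c_n tⁿ` to which `h_n` is specialized, for `n = i + 1`. -/
def specVar (A : Type*) [CommRing A] (c : ℕ → ℤ) (i : ℕ) : A⟦X⟧ :=
  PowerSeries.C (c i : A) * PowerSeries.X ^ (i + 1)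

/-- The specialization `h_n ↦ c_n tⁿ` of `Λ`. -/
def spec (A : Type*) [CommRing A] (c : ℕ → ℤ) : Lam →ₐ[ℤ] A⟦X⟧ := aeval (specVar A c)

section Spec

variable {A : Type*} [CommRing A] (c : ℕ → ℤ)

theorem coeff_specVar (i n : ℕ) :
    PowerSeries.coeff n (specVar A c i) = if n = i + 1 then (c i : A) else 0 := by
  rw [specVar, PowerSeries.coeff_C_mul, PowerSeries.coeff_X_pow, mul_ite, mul_one, mul_zero]

theorem hasSubst_specVar : MvPowerSeries.HasSubst (specVar A c) where
  const_coeff i := by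
    have : MvPowerSeries.constantCoeff (specVar A c i) = 0 :=
      (PowerSeries.coeff_zero_eq_constantCoeff_apply (specVar A c i)).symm.trans
        ((coeff_specVar c i 0).trans (if_neg (by omega)))
    rw [this]
    exact IsNilpotent.zero
  coeff_zero d := by
    obtain ⟨n, rfl⟩ : ∃ n : ℕ, d = Finsupp.single () n := ⟨d (), by ext; simp⟩
    refine (Set.finite_Iio (n + 1)).subset fun i hi => ?_
    have h1 : PowerSeries.coeff n (specVar A c i) ≠ 0 := hi
    rw [coeff_specVar] at h1
    simp only [Set.mem_Iio]
    by_contra h2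
    exact h1 (if_neg (by omega))

theorem prod_specVar (m : ℕ →₀ ℕ) :
    (m.prod fun i e => specVar A c i ^ e) =
      PowerSeries.C (m.prod fun i e => (c i : A) ^ e) * PowerSeries.X ^ wt m := by
  simp only [specVar, mul_pow, ← pow_mul, Finsupp.prod, Finset.prod_mul_distrib, map_prod, map_pow]
  rw [Finset.prod_pow_eq_pow_sum]
  congr 2
  rw [wt, Finsupp.weight_apply, Finsupp.sum]
  exact Finset.sum_congr rfl fun i _ => by rw [smul_eq_mul, mul_comm]

/-- The specialization is graded, so only monomials of weight `n` reach `tⁿ`, and these are the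
`h_ν` with `ν ⊢ n`. -/
theorem coeff_subst_specVar (F : MvPowerSeries ℕ A) (n : ℕ) :
    PowerSeries.coeff n (MvPowerSeries.subst (specVar A c) F : A⟦X⟧) =
      ∑ ν : n.Partition,
        MvPowerSeries.coeff (expo ν) F * (expo ν).prod fun i e => (c i : A) ^ e := by
  classical
  have h1 : ∀ m : ℕ →₀ ℕ, PowerSeries.coeff n (m.prod fun i e => specVar A c i ^ e) =
      if wt m = n then m.prod fun i e => (c i : A) ^ e else 0 := by
    intro m
    rw [prod_specVar, PowerSeries.coeff_C_mul, PowerSeries.coeff_X_pow]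
    simp [eq_comm]
  have h2 : PowerSeries.coeff n (MvPowerSeries.subst (specVar A c) F : A⟦X⟧) =
      finsum fun m : ℕ →₀ ℕ => MvPowerSeries.coeff m F •
        PowerSeries.coeff n (m.prod fun i e => specVar A c i ^ e) :=
    MvPowerSeries.coeff_subst (hasSubst_specVar c) F _
  rw [h2, finsum_eq_sum_of_support_subset (s := Finset.univ.image (expo (n := n)))]
  · rw [Finset.sum_image fun _ _ _ _ hh => expo_injective hh]
    refine Finset.sum_congr rfl fun ν _ => ?_
    rw [h1, if_pos (wt_expo ν), smul_eq_mul]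
  · intro m hm
    rw [Function.mem_support, h1] at hm
    have hw : wt m = n := by
      by_contra hw
      exact hm (by rw [if_neg hw, smul_zero])
    obtain ⟨ν, hν⟩ := exists_expo m hw
    simp [← hν]

theorem subst_specVar_map (f : Lam) :
    MvPowerSeries.subst (specVar A c)
      ((MvPolynomial.map (Int.castRingHom A) f : MvPolynomial ℕ A) : MvPowerSeries ℕ A) =
      spec A c f := by
  rw [MvPowerSeries.subst_coe, spec]
  exact aeval_map_algebraMap A (specVar A c) f

theorem isLogDeriv_map_spec :
    IsLogDeriv (PowerSeries.map (spec A c).toRingHom H)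
      (PowerSeries.map (spec A c).toRingHom (PowerSeries.mk p)) :=
  isLogDeriv_H.map _

end Spec

/-- Serves to read off the images of the power sums from the image of `H`. -/
theorem IsLogDeriv.unique {A : Type*} [CommRing A] {f g g' f' : A⟦X⟧} (h : IsLogDeriv f g)
    (h' : IsLogDeriv f g') (hf : f * f' = 1) : g = g' := by
  unfold IsLogDeriv at *
  linear_combination (g' - g) * hf + f' * (h' - h)

theorem isLogDeriv_one_sub {A : Type*} [CommRing A] (a : A) :
    IsLogDeriv (geomUnit a).inv (-(PowerSeries.C a * PowerSeries.X * (geomUnit a).val)) := by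
  have h1 : (geomUnit a).val * (geomUnit a).inv = 1 := (geomUnit a).val_inv
  have h2 : PowerSeries.X * PowerSeries.derivative A (geomUnit a).inv =
      -(PowerSeries.C a * PowerSeries.X) := by
    simp [geomUnit, Derivation.leibniz, mul_comm]
  unfold IsLogDeriv
  linear_combination h2 + PowerSeries.C a * PowerSeries.X * h1

theorem coeff_C_mul_X_mul_geomUnit {A : Type*} [CommRing A] (a : A) {n : ℕ} (hn : n ≠ 0) :
    PowerSeries.coeff n (PowerSeries.C a * PowerSeries.X * (geomUnit a : A⟦X⟧)) = a ^ n := by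
  obtain ⟨n, rfl⟩ := Nat.exists_eq_succ_of_ne_zero hn
  rw [mul_assoc, PowerSeries.coeff_C_mul, Nat.succ_eq_add_one, PowerSeries.coeff_succ_X_mul]
  simp [geomUnit, pow_succ']

/-! ### The two specializations that detect `s_(n)` and `s_{1ⁿ}` -/

/-- The specialization to one variable: `h_n ↦ tⁿ`. -/
def rowWeight : ℕ → ℤ := 1

/-- The dual specialization: `h_1 ↦ t` and `h_n ↦ 0` for `n ≥ 2`. -/
def columnWeight : ℕ → ℤ := Pi.single 0 1

section

variable (A : Type*) [CommRing A]

theorem spec_row_h (n : ℕ) : spec A rowWeight (h n) = PowerSeries.X ^ n := by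
  cases n with
  | zero => simp [h]
  | succ n => simp [h, spec, specVar, rowWeight]

theorem spec_column_h_zero : spec A columnWeight (h 0) = 1 := by
  simp [h]

theorem spec_column_h_one : spec A columnWeight (h 1) = PowerSeries.X := by
  simp [h, spec, specVar, columnWeight]

theorem spec_column_h {n : ℕ} (hn : 2 ≤ n) : spec A columnWeight (h n) = 0 := by
  obtain ⟨n, rfl⟩ := Nat.exists_eq_add_of_le' hn
  simp [h, spec, specVar, columnWeight]

theorem spec_row_p {n : ℕ} (hn : n ≠ 0) : spec A rowWeight (p n) = PowerSeries.X ^ n := by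
  -- Over `A⟦X⟧`, with generating variable `u`, the image of `H_u` is `1 / (1 - X u)`.
  have h1 : PowerSeries.map (spec A rowWeight).toRingHom H =
      (geomUnit (PowerSeries.X : A⟦X⟧) : A⟦X⟧⟦X⟧) := by
    ext1 n
    simpa [H, geomUnit] using spec_row_h A n
  have h2 := isLogDeriv_map_spec (A := A) rowWeight
  rw [h1] at h2
  have h3 := (isLogDeriv_one_sub (PowerSeries.X : A⟦X⟧)).of_mul_eq_one (geomUnit _).inv_val
  rw [neg_neg] at h3
  have h4 := congrArg (PowerSeries.coeff n) (h2.unique h3 (geomUnit _).val_inv)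
  rw [coeff_C_mul_X_mul_geomUnit _ hn] at h4
  simpa using h4

theorem spec_column_p {n : ℕ} (hn : n ≠ 0) :
    spec A columnWeight (p n) = PowerSeries.C (-(-1) ^ n) * PowerSeries.X ^ n := by
  -- With generating variable `u`, the image of `H_u` is `1 + X u`.
  have h1 : PowerSeries.map (spec A columnWeight).toRingHom H =
      (geomUnit (-PowerSeries.X : A⟦X⟧)).inv := by
    ext1 n
    rcases n with _ | _ | n
    · simpa [H, geomUnit] using spec_column_h_zero A
    · simpa [H, geomUnit, PowerSeries.coeff_one] using spec_column_h_one A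
    · simpa [H, geomUnit, PowerSeries.coeff_one, PowerSeries.coeff_X] using
        spec_column_h A (n := n + 2) (by omega)
  have h2 := isLogDeriv_map_spec (A := A) columnWeight
  rw [h1] at h2
  have h4 := congrArg (PowerSeries.coeff n)
    (h2.unique (isLogDeriv_one_sub _) (geomUnit _).inv_val)
  rw [map_neg, coeff_C_mul_X_mul_geomUnit _ hn] at h4
  rw [neg_pow] at h4
  simpa using h4

theorem spec_schur {n : ℕ} (c : ℕ → ℤ) (μ : n.Partition) :
    spec A c (schur μ) = (Matrix.of fun i j : Fin (μ.parts.sort (· ≥ ·)).length =>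
      spec A c (hInt (((μ.parts.sort (· ≥ ·)).get i : ℤ) - (i : ℤ) + (j : ℤ)))).det := by
  rw [schur, AlgHom.map_det]
  rfl

theorem partition_get_pos {n : ℕ} (μ : n.Partition) (i : Fin (μ.parts.sort (· ≥ ·)).length) :
    0 < (μ.parts.sort (· ≥ ·)).get i :=
  μ.parts_pos ((Multiset.mem_sort _).1 (List.get_mem _ i))

theorem hInt_natCast (n : ℕ) : hInt (n : ℤ) = h n := rfl

theorem spec_row_schur {n : ℕ} (μ : n.Partition) :
    spec A rowWeight (schur μ) = if μ = row n then PowerSeries.X ^ n else 0 := by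
  rw [spec_schur]
  have hpos := partition_get_pos μ
  have hanti : ∀ i j : Fin (μ.parts.sort (· ≥ ·)).length, i < j →
      (μ.parts.sort (· ≥ ·)).get j ≤ (μ.parts.sort (· ≥ ·)).get i :=
    fun i j hij => (Multiset.pairwise_sort μ.parts (· ≥ ·)).rel_get_of_lt hij
  have hL : ((μ.parts.sort (· ≥ ·) : List ℕ) : Multiset ℕ) = μ.parts := Multiset.sort_eq _ _
  have hsum := μ.parts_sum
  rw [← hL, Multiset.sum_coe] at hsum
  -- Length `0` must be allowed: the row is empty for `n = 0`.
  have hrow : μ = row n ↔ (μ.parts.sort (· ≥ ·)).length ≤ 1 := by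
    have hcard : (μ.parts.sort (· ≥ ·)).length = μ.parts.card := by
      rw [← Multiset.coe_card, hL]
    constructor
    · intro hμ
      rw [hcard, hμ]
      rcases Nat.eq_zero_or_pos n with rfl | hn
      · simp
      · rw [Nat.Partition.indiscrete_parts hn.ne']; simp
    · intro hl
      apply Nat.Partition.ext
      rcases Nat.eq_zero_or_pos n with rfl | hn
      · simp
      · rw [Nat.Partition.indiscrete_parts hn.ne']
        rcases Nat.le_one_iff_eq_zero_or_eq_one.1 (hcard ▸ hl) with h0 | h1
        · have := μ.parts_sum
          rw [Multiset.card_eq_zero.1 h0] at this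
          simp at this; omega
        · obtain ⟨a, ha⟩ := Multiset.card_eq_one.1 h1
          have := μ.parts_sum
          rw [ha] at this ⊢
          simpa using this
  generalize μ.parts.sort (· ≥ ·) = L at *
  split_ifs with hμ
  · have hl := hrow.1 hμ
    match L, hl with
    | [], _ => simp at hsum; simp [← hsum]
    | [a], _ =>
      simp at hsum
      change Matrix.det (n := Fin 1) _ = _
      rw [Matrix.det_fin_one]
      simp [hsum, hInt_natCast, spec_row_h]
  · have hl : 1 < L.length := by
      by_contra hl
      exact hμ (hrow.2 (by omega))
    have h01 := hanti ⟨0, by omega⟩ ⟨1, hl⟩ (by simp [Fin.lt_def])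
    have h1 := hpos ⟨1, hl⟩
    set a := L.get ⟨0, by omega⟩ with ha
    set b := L.get ⟨1, hl⟩ with hb
    -- The first two rows have entries `X^(a + j)` and `X^(b - 1 + j)`, with no negative index
    -- because `b ≥ 1`; hence the first is `X^(a - b + 1)` times the second.
    rw [← Matrix.det_updateRow_add_smul_self _ (i := ⟨0, by omega⟩) (j := ⟨1, hl⟩)
      (by simp [Fin.ext_iff]) (-PowerSeries.X ^ (a - b + 1))]
    apply Matrix.det_eq_zero_of_row_eq_zero ⟨0, by omega⟩
    intro j
    have e1 : (a : ℤ) - ((0 : ℕ) : ℤ) + (j : ℕ) = ((a + j : ℕ) : ℤ) := by push_cast; ring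
    have e2 : (b : ℤ) - ((1 : ℕ) : ℤ) + (j : ℕ) = ((b - 1 + j : ℕ) : ℤ) := by omega
    rw [Matrix.updateRow_self]
    simp only [Pi.add_apply, Pi.smul_apply, Matrix.of_apply, smul_eq_mul, ← ha, ← hb]
    rw [e1, e2, hInt_natCast, hInt_natCast, spec_row_h, spec_row_h, neg_mul, ← pow_add,
      show a - b + 1 + (b - 1 + (j : ℕ)) = a + j by omega]
    ring

theorem spec_column_schur {n : ℕ} (μ : n.Partition) :
    spec A columnWeight (schur μ) = if μ = column n then PowerSeries.X ^ n else 0 := by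
  rw [spec_schur]
  have hpos := partition_get_pos μ
  have hanti : ∀ i j : Fin (μ.parts.sort (· ≥ ·)).length, i < j →
      (μ.parts.sort (· ≥ ·)).get j ≤ (μ.parts.sort (· ≥ ·)).get i :=
    fun i j hij => (Multiset.pairwise_sort μ.parts (· ≥ ·)).rel_get_of_lt hij
  have hL : ((μ.parts.sort (· ≥ ·) : List ℕ) : Multiset ℕ) = μ.parts := Multiset.sort_eq _ _
  have hsum := μ.parts_sum
  have hcol : μ = column n ↔ ∀ i, (μ.parts.sort (· ≥ ·)).get i = 1 := by
    have hmem : (∀ i, (μ.parts.sort (· ≥ ·)).get i = 1) ↔ ∀ x ∈ μ.parts, x = 1 := by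
      simp only [← Multiset.mem_sort (s := μ.parts) (· ≥ ·), List.forall_mem_iff_get]
    rw [hmem, ← Multiset.eq_replicate_card]
    constructor
    · intro hμ
      rw [hμ]; simp [column]
    · intro hμ
      have hc : μ.parts.card = n := by
        have h1 := μ.parts_sum
        rw [hμ] at h1
        simpa using h1
      apply Nat.Partition.ext
      rw [hμ, hc]; rfl
  rw [← hL, Multiset.sum_coe] at hsum
  generalize μ.parts.sort (· ≥ ·) = L at *
  split_ifs with hμ
  · have h1 := hcol.1 hμ
    have hlen : L.length = n := by
      have : L = List.replicate L.length 1 := List.eq_replicate_iff.2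
        ⟨rfl, List.forall_mem_iff_get.2 h1⟩
      rw [this] at hsum
      simpa using hsum
    -- When all parts are `1`, the diagonal entries are `h_1 ↦ X`, and those above the diagonal are
    -- `h_n` with `n ≥ 2`, which vanish.
    rw [Matrix.det_of_isLowerTriangular]
    · simp only [Matrix.of_apply, h1]
      rw [← hlen]
      simp only [sub_add_cancel]
      rw [show hInt ((1 : ℕ) : ℤ) = h 1 from rfl, spec_column_h_one]
      simp
    · intro i j hij
      have hij' : (i : ℕ) < j := hij
      obtain ⟨k, hk⟩ := Nat.exists_eq_add_of_lt hij'
      rw [Matrix.of_apply, h1, hk, show (((1 : ℕ) : ℤ) - (i : ℕ) + ((i + k + 1 : ℕ) : ℤ)) =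
        ((k + 2 : ℕ) : ℤ) by push_cast; ring, hInt_natCast]
      exact spec_column_h A (by omega)
  · have h1 : ∃ i, L.get i ≠ 1 := by
      by_contra hh
      push Not at hh
      exact hμ (hcol.2 hh)
    obtain ⟨i, hi⟩ := h1
    have hl : 0 < L.length := by have := i.2; omega
    have h2 : 2 ≤ L.get ⟨0, hl⟩ := by
      have h3 := hpos i
      rcases Nat.eq_zero_or_pos (i : ℕ) with h0 | h0
      · have : i = ⟨0, hl⟩ := Fin.ext h0
        rw [← this]; omega
      · have := hanti ⟨0, hl⟩ i (by simpa [Fin.lt_def] using h0)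
        omega
    -- The largest part is at least `2`, so the whole first row consists of `h_n` with `n ≥ 2`.
    apply Matrix.det_eq_zero_of_row_eq_zero ⟨0, hl⟩
    intro j
    rw [Matrix.of_apply, show ((L.get ⟨0, hl⟩ : ℕ) : ℤ) - ((0 : ℕ) : ℤ) + ((j : ℕ) : ℤ) =
      ((L.get ⟨0, hl⟩ + j : ℕ) : ℤ) by push_cast; ring, hInt_natCast]
    exact spec_column_h A (by omega)

end

/-! ### The coefficients of `s_(n)` and `s_{1ⁿ}` in `Φ(x)` -/

/-- `∑_{d ∣ k} μ(k/d) p_d`, which is `k` times the exponent of `1 + p_k` in `Φ(x)`. -/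
def necklace (k : ℕ) : LamQ :=
  ∑ d ∈ k.divisors, (ArithmeticFunction.moebius (k / d) : LamQ) * toLamQ (p d)

theorem natCast_mul_expoPhi {k : ℕ} (hk : k ≠ 0) : (k : LamQ) * expoPhi k = necklace k := by
  have hq : (k : ℚ) ≠ 0 := Nat.cast_ne_zero.2 hk
  rw [expoPhi, ← necklace, ← nsmul_eq_mul, ← Nat.cast_smul_eq_nsmul ℚ, smul_smul,
    mul_one_div_cancel hq, one_smul]

theorem sum_divisors_necklace {n : ℕ} (hn : n ≠ 0) :
    ∑ k ∈ n.divisors, necklace k = toLamQ (p n) := by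
  refine (ArithmeticFunction.sum_eq_iff_sum_mul_moebius_eq (f := necklace)
    (g := fun n => toLamQ (p n))).2 (fun k _ => ?_) n (Nat.pos_of_ne_zero hn)
  rw [Nat.sum_divisorsAntidiagonal' fun a b => (ArithmeticFunction.moebius a : LamQ) * toLamQ (p b)]
  rfl

theorem subst_specVar_phiFactor (c : ℕ → ℤ) (ε : LamQ) {k : ℕ}
    (hp : spec LamQ c (p k) = PowerSeries.C ε * PowerSeries.X ^ k) :
    MvPowerSeries.subst (specVar LamQ c) (phiFactor k) =
      PowerSeries.subst (PowerSeries.C ε * PowerSeries.X ^ k : LamQ⟦X⟧)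
        (PowerSeries.binomialSeries LamQ (expoPhi k)) := by
  rw [phiFactor, ← hp, ← subst_specVar_map]
  exact MvPowerSeries.subst_comp_subst_apply (hasSubst_pSeries k).const (hasSubst_specVar c) _

/-- In degree `n` the specialization annihilates every `s_μ` but `s_{μ₀}`, so it maps `∑ s_μ ⊗ φ_μ`
to `φ_{μ₀} tⁿ`. All monomials of degree `n` see the same truncated product, so `Φ(x)` may be
replaced by a finite product. -/
theorem phiQ_eq_coeff_prod (c : ℕ → ℤ) {n : ℕ} (μ₀ : n.Partition)
    (hs : ∀ μ : n.Partition, spec LamQ c (schur μ) = if μ = μ₀ then PowerSeries.X ^ n else 0) :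
    phiQ μ₀ = PowerSeries.coeff n
      (∏ k ∈ Finset.Icc 1 n, (MvPowerSeries.subst (specVar LamQ c) (phiFactor k) : LamQ⟦X⟧)) := by
  classical
  have hspec : ∀ ν : n.Partition,
      MvPowerSeries.coeff (expo ν) (∏ k ∈ Finset.Icc 1 n, phiFactor k) =
        ∑ μ : n.Partition, ((coeff (expo ν) (schur μ) : ℤ) : LamQ) * phiQ μ := by
    intro ν
    have h1 := (existsUnique_schur_expansion phiSeries n).choose_spec.1 (expo ν) (wt_expo ν)
    refine Eq.trans ?_ h1
    have h2 : MvPowerSeries.coeff (expo ν) phiSeries = MvPowerSeries.coeff (expo ν)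
      (∏ k ∈ Finset.Icc 1 (wt (expo ν)), phiFactor k) := rfl
    rw [h2, wt_expo]
  have hprod : (∏ k ∈ Finset.Icc 1 n,
      (MvPowerSeries.subst (specVar LamQ c) (phiFactor k) : LamQ⟦X⟧)) =
      MvPowerSeries.subst (specVar LamQ c) (∏ k ∈ Finset.Icc 1 n, phiFactor k) := by
    have := map_prod (MvPowerSeries.substAlgHom (R := LamQ) (hasSubst_specVar (A := LamQ) c))
      phiFactor (Finset.Icc 1 n)
    simp only [MvPowerSeries.coe_substAlgHom] at this
    exact this.symm
  have hcoeff : ∀ μ : n.Partition, ∑ ν : n.Partition, ((coeff (expo ν) (schur μ) : ℤ) : LamQ) *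
      ((expo ν).prod fun i e => (c i : LamQ) ^ e) = if μ = μ₀ then 1 else 0 := by
    intro μ
    have h1 := congrArg (PowerSeries.coeff n) (hs μ)
    rw [← subst_specVar_map, coeff_subst_specVar] at h1
    simp only [MvPolynomial.coeff_coe, MvPolynomial.coeff_map] at h1
    refine h1.trans ?_
    split_ifs <;> simp
  rw [hprod, coeff_subst_specVar]
  simp only [hspec, Finset.sum_mul]
  rw [Finset.sum_comm]
  have hrw : ∀ μ ν : n.Partition, ((coeff (expo ν) (schur μ) : ℤ) : LamQ) * phiQ μ *
      ((expo ν).prod fun i e => (c i : LamQ) ^ e) = phiQ μ *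
      (((coeff (expo ν) (schur μ) : ℤ) : LamQ) *
        ((expo ν).prod fun i e => (c i : LamQ) ^ e)) := fun μ ν => by ring
  simp only [hrw, ← Finset.mul_sum, hcoeff]
  simp

/-- A coefficient of `Φ(x)` is detected by a specialization with `p_k ↦ ε_k tᵏ`, by comparing
logarithmic derivatives. -/
theorem phiQ_eq_coeff (c : ℕ → ℤ) (ε : ℕ → LamQ) {n : ℕ} (μ₀ : n.Partition)
    (hs : ∀ μ : n.Partition, spec LamQ c (schur μ) = if μ = μ₀ then PowerSeries.X ^ n else 0)
    (hp : ∀ k ≠ 0, spec LamQ c (p k) = PowerSeries.C (ε k) * PowerSeries.X ^ k)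
    {f g : LamQ⟦X⟧} (hfg : IsLogDeriv f g) (hf : PowerSeries.coeff 0 f = 1)
    (hg : PowerSeries.coeff 0 g = 0)
    (hgm : ∀ m ≠ 0, PowerSeries.coeff m g =
      ∑ k ∈ m.divisors, necklace k * -(-ε k) ^ (m / k)) :
    phiQ μ₀ = PowerSeries.coeff n f := by
  classical
  rw [phiQ_eq_coeff_prod c μ₀ hs]
  let u : ℕ → LamQ⟦X⟧ := fun k =>
    if hk : k ≠ 0 then PowerSeries.C (necklace k) * (1 - invOneAddPow (ε k) k hk) else 0
  have hfac : ∀ k ∈ Finset.Icc 1 n, IsLogDeriv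
      (MvPowerSeries.subst (specVar LamQ c) (phiFactor k) : LamQ⟦X⟧) (u k) := by
    intro k hk
    have hk0 : k ≠ 0 := by have := Finset.mem_Icc.1 hk; omega
    simp only [u, dif_pos hk0]
    rw [subst_specVar_phiFactor c (ε k) (hp k hk0), ← natCast_mul_expoPhi hk0]
    exact isLogDeriv_subst_binomialSeries _ _ k hk0
  symm
  refine hfg.coeff_eq (IsLogDeriv.prod _ hfac) ?_ hg n fun m hm => ?_
  · rw [hf, PowerSeries.coeff_zero_eq_constantCoeff_apply, map_prod]
    refine (Finset.prod_eq_one fun k hk => ?_).symm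
    have hk0 : k ≠ 0 := by have := Finset.mem_Icc.1 hk; omega
    rw [subst_specVar_phiFactor c (ε k) (hp k hk0)]
    have hsub := hasSubst_C_mul_X_pow (ε k) hk0
    -- Subtracting `1` leaves a series without constant term, and substitution preserves that.
    have h1 : PowerSeries.constantCoeff (PowerSeries.subst
        (PowerSeries.C (ε k) * PowerSeries.X ^ k : LamQ⟦X⟧)
        (PowerSeries.binomialSeries LamQ (expoPhi k) - 1)) = 0 :=
      PowerSeries.constantCoeff_subst_eq_zero (by
        change PowerSeries.constantCoeff _ = 0
        simp [hk0]) _ (by simp)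
    rw [PowerSeries.subst_sub hsub, map_sub, ← PowerSeries.coe_substAlgHom hsub, map_one, map_one,
      sub_eq_zero] at h1
    rw [← h1, PowerSeries.coe_substAlgHom hsub]
  · rcases Nat.eq_zero_or_pos m with rfl | hm0
    · rw [hg, map_sum]
      refine (Finset.sum_eq_zero fun k hk => ?_).symm
      have hk0 : k ≠ 0 := by have := Finset.mem_Icc.1 hk; omega
      simp [u, hk0, invOneAddPow, geomUnit]
    · rw [hgm m hm0.ne', map_sum]
      have hu : ∀ k ∈ Finset.Icc 1 n, PowerSeries.coeff m (u k) =
          if k ∣ m then necklace k * -(-ε k) ^ (m / k) else 0 := by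
        intro k hk
        have hk0 : k ≠ 0 := by have := Finset.mem_Icc.1 hk; omega
        simp only [u, dif_pos hk0]
        rw [PowerSeries.coeff_C_mul, coeff_one_sub_invOneAddPow _ _ _ hm0.ne', mul_ite, mul_zero]
      rw [Finset.sum_congr rfl hu, ← Finset.sum_filter]
      refine Finset.sum_congr ?_ fun _ _ => rfl
      -- As `0 < m ≤ n`, every divisor of `m` lies in the truncated range `1 ≤ k ≤ n`.
      ext k
      simp only [Nat.mem_divisors, Finset.mem_filter, Finset.mem_Icc]
      constructor
      · rintro ⟨hk, -⟩
        have := Nat.le_of_dvd hm0 hk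
        have := Nat.pos_of_dvd_of_pos hk hm0
        exact ⟨by omega, hk⟩
      · rintro ⟨-, hk⟩
        exact ⟨hk, hm0.ne'⟩

/-! ### The closed forms over `Λ` and their logarithmic derivatives -/

/-- `H_t / H_{t²}`. -/
def rowSeries : Lam⟦X⟧ := H * PowerSeries.invOfUnit (PowerSeries.expand 2 two_ne_zero H) 1

/-- `1 / H_{-t}`, the generating series of the elementary symmetric functions. -/
def columnSeries : Lam⟦X⟧ := PowerSeries.invOfUnit (PowerSeries.rescale (-1) H) 1

theorem constantCoeff_H : PowerSeries.constantCoeff H = 1 := by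
  simp [H, h]

theorem expand_H_mul_inv : PowerSeries.expand 2 two_ne_zero H *
    PowerSeries.invOfUnit (PowerSeries.expand 2 two_ne_zero H) 1 = 1 :=
  PowerSeries.mul_invOfUnit _ _ (by simp [constantCoeff_H])

theorem constantCoeff_rescale_H : PowerSeries.constantCoeff (PowerSeries.rescale (-1) H) = 1 := by
  rw [← PowerSeries.coeff_zero_eq_constantCoeff_apply, PowerSeries.coeff_rescale]
  simp [constantCoeff_H]

theorem rescale_H_mul_columnSeries : PowerSeries.rescale (-1) H * columnSeries = 1 :=
  PowerSeries.mul_invOfUnit _ _ (by simp [constantCoeff_rescale_H])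

theorem isLogDeriv_rowSeries : IsLogDeriv rowSeries
    (PowerSeries.mk p + -((2 : ℕ) * PowerSeries.expand 2 two_ne_zero (PowerSeries.mk p))) :=
  isLogDeriv_H.mul ((isLogDeriv_H.expand two_ne_zero).of_mul_eq_one expand_H_mul_inv)

theorem isLogDeriv_columnSeries :
    IsLogDeriv columnSeries (-PowerSeries.rescale (-1) (PowerSeries.mk p)) :=
  (isLogDeriv_H.rescale (-1)).of_mul_eq_one rescale_H_mul_columnSeries

/-- The sign `-(-1)^(m/k)` is `1 - 2 [2 ∣ m/k]`, and the `k` with `2 ∣ m/k` are exactly the divisors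
of `m/2`; apply Möbius inversion at `m` and at `m/2`. -/
theorem sum_divisors_necklace_mul_neg_one_pow {m : ℕ} (hm : m ≠ 0) :
    ∑ k ∈ m.divisors, necklace k * -(-1) ^ (m / k) =
      toLamQ (p m) - 2 * if 2 ∣ m then toLamQ (p (m / 2)) else 0 := by
  have h1 : ∀ k ∈ m.divisors, necklace k * -(-1) ^ (m / k) =
      necklace k - 2 * if 2 ∣ m / k then necklace k else 0 := by
    intro k _
    split_ifs with h2
    · rw [(even_iff_two_dvd.2 h2).neg_one_pow]; ring
    · rw [(Nat.not_even_iff_odd.1 fun h => h2 (even_iff_two_dvd.1 h)).neg_one_pow]; ring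
  rw [Finset.sum_congr rfl h1, Finset.sum_sub_distrib, sum_divisors_necklace hm, ← Finset.mul_sum,
    ← Finset.sum_filter]
  congr 2
  split_ifs with h2
  · obtain ⟨j, rfl⟩ := h2
    have hj : j ≠ 0 := by omega
    rw [Nat.mul_div_cancel_left _ two_pos, ← sum_divisors_necklace hj]
    refine Finset.sum_congr ?_ fun _ _ => rfl
    ext k
    simp only [Nat.mem_divisors, Finset.mem_filter]
    constructor
    · rintro ⟨⟨hk, -⟩, h2⟩
      refine ⟨?_, hj⟩
      obtain ⟨i, hi⟩ := (Nat.dvd_div_iff_mul_dvd hk).1 h2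
      exact ⟨i, by
        have : 2 * j = 2 * (k * i) := by rw [hi]; ring
        omega⟩
    · rintro ⟨⟨i, rfl⟩, -⟩
      have hk : k ∣ 2 * (k * i) := ⟨2 * i, by ring⟩
      exact ⟨⟨hk, hm⟩, (Nat.dvd_div_iff_mul_dvd hk).2 ⟨i, by ring⟩⟩
  · refine Finset.sum_eq_zero fun k hk => ?_
    simp only [Nat.mem_divisors, Finset.mem_filter] at hk
    exact absurd ((dvd_mul_right 2 k).trans (by
      rw [mul_comm]; exact (Nat.dvd_div_iff_mul_dvd hk.1.1).1 hk.2)) h2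

theorem phiQ_row (n : ℕ) : phiQ (row n) = toLamQ (PowerSeries.coeff n rowSeries) := by
  have hcoeff : ∀ m, PowerSeries.coeff m (PowerSeries.map toLamQ
      (PowerSeries.mk p + -((2 : ℕ) * PowerSeries.expand 2 two_ne_zero (PowerSeries.mk p)))) =
      toLamQ (p m) - 2 * if 2 ∣ m then toLamQ (p (m / 2)) else 0 := by
    intro m
    rw [PowerSeries.coeff_map, map_add, map_neg, ← map_natCast (PowerSeries.C (R := Lam)),
      PowerSeries.coeff_C_mul, PowerSeries.coeff_expand, PowerSeries.coeff_mk]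
    have h2 : toLamQ 2 = 2 := map_ofNat _ 2
    split_ifs <;> simp [sub_eq_add_neg, h2]
  rw [← PowerSeries.coeff_map]
  refine phiQ_eq_coeff rowWeight (fun _ => 1) (row n) (fun μ => spec_row_schur LamQ μ)
    (fun k hk => ?_) (isLogDeriv_rowSeries.map toLamQ) ?_ ?_ fun m hm => ?_
  · rw [spec_row_p LamQ hk, map_one, one_mul]
  · rw [PowerSeries.coeff_map]; simp [rowSeries, constantCoeff_H]
  · rw [hcoeff]; simp [p_zero]
  · rw [hcoeff, sum_divisors_necklace_mul_neg_one_pow hm]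

theorem phiQ_column (n : ℕ) : phiQ (column n) = toLamQ (PowerSeries.coeff n columnSeries) := by
  rw [← PowerSeries.coeff_map]
  refine phiQ_eq_coeff columnWeight (fun k => -(-1) ^ k) (column n)
    (fun μ => spec_column_schur LamQ μ)
    (fun k hk => spec_column_p LamQ hk) (isLogDeriv_columnSeries.map toLamQ) ?_ ?_ fun m hm => ?_
  · simp [columnSeries]
  · rw [PowerSeries.coeff_map, map_neg, PowerSeries.coeff_rescale]; simp [p_zero]
  -- Because `((-1)^k)^(m/k) = (-1)^m`, the sign does not depend on `k`.
  · have h1 : ∀ k ∈ m.divisors, necklace k * -(-(-(-1) ^ k)) ^ (m / k) =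
        -(-1) ^ m * necklace k := by
      intro k hk
      rw [neg_neg, ← pow_mul, Nat.mul_div_cancel' (Nat.dvd_of_mem_divisors hk)]
      ring
    rw [Finset.sum_congr rfl h1, ← Finset.mul_sum, sum_divisors_necklace hm,
      PowerSeries.coeff_map, map_neg, PowerSeries.coeff_rescale, PowerSeries.coeff_mk]
    simp

theorem toLamQ_injective : Function.Injective toLamQ :=
  MvPolynomial.map_injective _ (Int.castRingHom ℚ).injective_int

/-- `Function.invFun` returns a true preimage only once one exists; the witness `f` is the
integrality of `φ_μ`. -/
theorem toLamQ_phi {n : ℕ} (μ : n.Partition) {f : Lam} (hf : phiQ μ = toLamQ f) :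
    toLamQ (phi μ) = phiQ μ :=
  Function.invFun_eq ⟨f, hf.symm⟩

theorem phi_eq {n : ℕ} (μ : n.Partition) {f : Lam} (hf : phiQ μ = toLamQ f) : phi μ = f :=
  toLamQ_injective ((toLamQ_phi μ hf).trans hf)

/-! ### Evaluation of the closed forms at an element of a pre-λ-ring -/

section Operations

variable {R : Type*} [CommRing R] [PreLambdaRing R]

/-- `f ↦ f ∘ a` as a ring homomorphism. -/
def circHom (a : R) : Lam →+* R := (aeval fun i : ℕ => sigma (i + 1) a).toRingHom

theorem map_circHom_H (a : R) : PowerSeries.map (circHom a) H = sigmaT a := by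
  ext n
  cases n with
  | zero =>
    have : PowerSeries.coeff 0 (sigmaT a) = 1 := PreLambdaRing.coeff_zero_sigmaT a
    rw [this]
    simp [H, h]
  | succ n => simp [H, h, circHom, sigma]

theorem map_invOfUnit {A B : Type*} [CommRing A] [CommRing B] (φ : A →+* B) (f : A⟦X⟧)
    (hf : PowerSeries.constantCoeff f = 1) :
    PowerSeries.map φ (PowerSeries.invOfUnit f 1) =
      PowerSeries.invOfUnit (PowerSeries.map φ f) 1 := by
  have h1 : PowerSeries.map φ f * PowerSeries.invOfUnit (PowerSeries.map φ f) 1 = 1 :=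
    PowerSeries.mul_invOfUnit _ _ (by
      rw [← PowerSeries.coeff_zero_eq_constantCoeff_apply, PowerSeries.coeff_map,
        PowerSeries.coeff_zero_eq_constantCoeff_apply, hf, map_one, Units.val_one])
  have h2 := congrArg (PowerSeries.map φ)
    (PowerSeries.mul_invOfUnit f 1 (by rw [hf, Units.val_one]))
  rw [map_one, RingHom.map_mul] at h2
  linear_combination PowerSeries.invOfUnit (PowerSeries.map φ f) 1 * h2 -
    PowerSeries.map φ (PowerSeries.invOfUnit f 1) * h1

theorem sigmaT_mul_sigmaT_neg (a : R) : sigmaT a * sigmaT (-a) = 1 := by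
  have hadd : ∀ a b : R, sigmaT (a + b) = sigmaT a * sigmaT b := PreLambdaRing.sigmaT_add
  -- `σ_t(0)` is idempotent by additivity and a unit by its constant term.
  have h0 : sigmaT (0 : R) = 1 := by
    have hu : IsUnit (sigmaT (0 : R)) := by
      rw [PowerSeries.isUnit_iff_constantCoeff, ← PowerSeries.coeff_zero_eq_constantCoeff_apply,
        show PowerSeries.coeff 0 (sigmaT (0 : R)) = 1 from PreLambdaRing.coeff_zero_sigmaT 0]
      exact isUnit_one
    have h1 := hadd 0 0
    rw [add_zero] at h1
    exact hu.mul_left_cancel (by rw [← h1, mul_one])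
  rw [← hadd, add_neg_cancel, h0]

theorem map_circHom_rowSeries (a : R) : PowerSeries.map (circHom a) rowSeries =
    sigmaT a * PowerSeries.invOfUnit (PowerSeries.expand 2 two_ne_zero (sigmaT a)) 1 := by
  rw [rowSeries, RingHom.map_mul, map_invOfUnit _ _ (by simp [constantCoeff_H]),
    PowerSeries.map_expand, map_circHom_H]

/-- The image of `1 / H_{-t}` and the series `σ_{-t}(-a) = ∑ λ_n(a) tⁿ` are both inverse to
`σ_{-t}(a)`. -/
theorem coeff_map_circHom_columnSeries (a : R) (n : ℕ) :
    PowerSeries.coeff n (PowerSeries.map (circHom a) columnSeries) = lambda n a := by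
  have h1 := congrArg (PowerSeries.map (circHom a)) rescale_H_mul_columnSeries
  have h2 : PowerSeries.map (circHom a) (PowerSeries.rescale (-1) H) =
      PowerSeries.rescale (-1) (sigmaT a) := by
    rw [← map_circHom_H]
    ext n
    simp [PowerSeries.coeff_rescale]
  have h3 := congrArg (PowerSeries.rescale (-1 : R)) (sigmaT_mul_sigmaT_neg a)
  rw [RingHom.map_mul, h2, map_one] at h1
  rw [RingHom.map_mul, map_one] at h3
  have h4 : PowerSeries.map (circHom a) columnSeries = PowerSeries.rescale (-1) (sigmaT (-a)) := by
    linear_combination PowerSeries.rescale (-1) (sigmaT (-a)) * h1 -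
      PowerSeries.map (circHom a) columnSeries * h3
  rw [h4, PowerSeries.coeff_rescale]
  rfl

end Operations

end SymFn

end

theorem mainTheorem6 :
    (∀ n : ℕ,
      SymFn.toLamQ (SymFn.phi (SymFn.row n)) = SymFn.phiQ (SymFn.row n) ∧
      SymFn.toLamQ (SymFn.phi (SymFn.column n)) = SymFn.phiQ (SymFn.column n)) ∧
    ∀ (R : Type*) [CommRing R] [SymFn.LambdaRing R] (y : R),
      PowerSeries.mk (fun n : ℕ => SymFn.Phi (SymFn.row n) y) =
        SymFn.sigmaT y *
          PowerSeries.invOfUnit (PowerSeries.expand 2 two_ne_zero (SymFn.sigmaT y)) 1 ∧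
      ∀ n : ℕ, SymFn.Phi (SymFn.column n) y = SymFn.lambda n y := by
  refine ⟨fun n => ⟨SymFn.toLamQ_phi _ (SymFn.phiQ_row n),
    SymFn.toLamQ_phi _ (SymFn.phiQ_column n)⟩, fun R _ _ y => ⟨?_, fun n => ?_⟩⟩
  · rw [← SymFn.map_circHom_rowSeries]
    ext n
    rw [PowerSeries.coeff_mk, PowerSeries.coeff_map, SymFn.Phi, SymFn.phi_eq _ (SymFn.phiQ_row n)]
    rfl
  · rw [← SymFn.coeff_map_circHom_columnSeries, PowerSeries.coeff_map, SymFn.Phi,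
      SymFn.phi_eq _ (SymFn.phiQ_column n)]
    rfl
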